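/- All graphs are finite; loops and parallel edges are allowed. For a graph $W$ with edge set $E_W$ let $\Lambda_W=\{0,1\}^{E_W}$ be its set of classical states. A state $\epsilon$ is connected if the graph obtained from $W$ by removing the edges $e$ with $\epsilon(e)=0$ (all vertices are kept) is connected. For $(p_e)_{e\in E_W}\in[0,1]^{E_W}$ let $R_W(p)=\sum_{\epsilon\ \text{connected}}\ \prod_{e}p_e^{\epsilon(e)}(1-p_e)^{1-\epsilon(e)}$ be the classical reliability. Let $\pi:S\to q\Lambda_W=S/U(1)$ be the quotient of the unit sphere $S$ of $\ell^2_{\mathbb C}(\Lambda_W)$ by global phases. A quantum reliability on $W$ is a smooth function $f:q\Lambda_W\to[0,1]$ such that (extension) $f\big(\pi(\bigotimes_e(p_e^{1/2}|1_e\rangle+(1-p_e)^{1/2}z_e|0_e\rangle))\big)=R_W(p)$ for all $p\in[0,1]^{E_W}$ and $z\in U(1)^{E_W}$, and (entanglement) $f\big(\pi(p^{1/2}|\zeta\rangle+(1-p)^{1/2}z|\chi\rangle)\big)=p$ for every connected state $\zeta$, every non connected state $\chi$, every $p\in[0,1]$ and every $z\in U(1)$. Let $\widehat{QR}_W$ be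 the orthogonal projection of $\ell^2_{\mathbb C}(\Lambda_W)$ onto the span of the $|\epsilon\rangle$ with $\epsilon$ connected, and $QR_W(\pi(|\psi\rangle))=\langle\psi|\widehat{QR}_W|\psi\rangle$. Let the graph $G$ be the union of two subgraphs $K$ and $H$ which have no common edge and share exactly the vertices $U=V(K)\cap V(H)\neq\emptyset$, so that $\Lambda_G=\Lambda_K\times\Lambda_H$ and $\ell^2_{\mathbb C}(\Lambda_G)=\ell^2_{\mathbb C}(\Lambda_K)\otimes\ell^2_{\mathbb C}(\Lambda_H)$. Let $\Gamma(U)$ be the set of partitions of $U$; for $\gamma\in\Gamma(U)$ let $K/\gamma$ and $H/\gamma$ be the graphs obtained by identifying the vertices in each block of $\gamma$ (their edge sets are those of $K$ and $H$). Let $\alpha_{\gamma,\gamma'}=1$ if the finest common coarsening of $\gamma$ and $\gamma'$ has a single block, and $\alpha_{\gamma,\gamma'}=0$ otherwise. The matrix $(\alpha_{\gamma,\gamma'})$ is invertible; let $(\beta_{\gamma,\gamma'})$ be its inverse. For each of the graphs $W=G$, $K/\gamma$, $H/\gamma$, the operator $\widehat{QR}_W$ is the unique self adjoint operator $L$ such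 that $\pi(|\psi\rangle)\mapsto\langle\psi|L|\psi\rangle$ is a quantum reliability on $W$. Moreover: 1. For all unit vectors $|\psi_K\rangle\in\ell^2_{\mathbb C}(\Lambda_K)$ and $|\psi_H\rangle\in\ell^2_{\mathbb C}(\Lambda_H)$, $$QR_G\big(\pi(|\psi_K\rangle\otimes|\psi_H\rangle)\big)=\sum_{\gamma,\gamma'\in\Gamma(U)}\beta_{\gamma,\gamma'}\,QR_{K/\gamma}\big(\pi(|\psi_K\rangle)\big)\,QR_{H/\gamma'}\big(\pi(|\psi_H\rangle)\big).$$ 2. For $p\in[0,1]^{E_G}$ and $z\in U(1)^{E_G}$ the non entangled vector $\bigotimes_{e\in E_G}(p_e^{1/2}|1_e\rangle+(1-p_e)^{1/2}z_e|0_e\rangle)$ is the tensor product of the corresponding vectors $|\psi_K\rangle$ for $K$ and $|\psi_H\rangle$ for $H$, one has $QR_G(\pi(|\psi_K\rangle\otimes|\psi_H\rangle))=R_G(p)$, $QR_{K/\gamma}(\pi(|\psi_K\rangle))=R_{K/\gamma}(p)$ and $QR_{H/\gamma}(\pi(|\psi_H\rangle))=R_{H/\gamma}(p)$, and hence the splitting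 becomes $$R_G(p)=\sum_{\gamma,\gamma'\in\Gamma(U)}\beta_{\gamma,\gamma'}\,R_{K/\gamma}(p)\,R_{H/\gamma'}(p).$$ 3. If $U$ consists of two vertices and $K$ is the graph with these two vertices and a single edge $e$ joining them, then for every $p\in[0,1]^{E_G}$ the right hand side of the last formula equals $p_e\,R_{G\cdot e}(p)+(1-p_e)\,R_{G-e}(p)$, so that $R_G(p)=p_e\,R_{G\cdot e}(p)+(1-p_e)\,R_{G-e}(p)$, where $G-e$ is $G$ with $e$ removed and $G\cdot e$ is $G$ with $e$ removed and its two ends identified. -/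

import Mathlib

open scoped Graph

namespace QNet

/-! ### Graphs: connectedness, identification of vertices, contraction of an edge

Graphs are Mathlib's multigraphs `Graph α β`: a set of vertices in `α`, a set of edges in `β`, loops
and parallel edges allowed. -/

section Graphs

variable {α β : Type*}

/-- A graph is connected if it has a vertex and any two vertices are joined by a path. -/
def IsConnected (W : Graph α β) : Prop :=
  V(W).Nonempty ∧ ∀ x ∈ V(W), ∀ y ∈ V(W), Relation.ReflTransGen W.Adj x y

/-- `G` is the union of its subgraphs `K` and `H`, which have no common edge. The shared vertices
are then the elements of `V(K) ∩ V(H)`. -/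
structure IsUnionOf (G K H : Graph α β) : Prop where
  left_le : K ≤ G
  right_le : H ≤ G
  vertexSet_eq : V(G) = V(K) ∪ V(H)
  edgeSet_eq : E(G) = E(K) ∪ E(H)
  edgeSet_disjoint : Disjoint E(K) E(H)

/-- The equivalence relation on all vertices which identifies the elements of each class of the
partition `γ` of `U`, and nothing else. -/
def identSetoid {U : Set α} (γ : Setoid U) : Setoid α where
  r x y := x = y ∨ ∃ (hx : x ∈ U) (hy : y ∈ U), γ ⟨x, hx⟩ ⟨y, hy⟩
  iseqv := by
    refine ⟨fun x => Or.inl rfl, ?_, ?_⟩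
    · rintro x y (rfl | ⟨hx, hy, h⟩)
      · exact Or.inl rfl
      · exact Or.inr ⟨hy, hx, γ.symm h⟩
    · rintro x y z (rfl | ⟨hx, hy, h⟩) (rfl | ⟨hy', hz, h'⟩)
      · exact Or.inl rfl
      · exact Or.inr ⟨hy', hz, h'⟩
      · exact Or.inr ⟨hx, hy, h⟩
      · exact Or.inr ⟨hx, hz, γ.trans h h'⟩

/-- The graph `W / γ`, obtained from `W` by identifying the vertices in each class of `γ`.
It has the same edges as `W` (definitionally). -/
def identify (W : Graph α β) {U : Set α} (γ : Setoid U) :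
    Graph (Quotient (identSetoid γ)) β :=
  W.map (Quotient.mk (identSetoid γ))

/-- The equivalence relation on vertices which identifies the two ends of the edge `e` of `W`. -/
def endsSetoid (W : Graph α β) (e : β) : Setoid α where
  r x y := x = y ∨ W.IsLink e x y
  iseqv := by
    refine ⟨fun x => Or.inl rfl, ?_, ?_⟩
    · rintro x y (rfl | h)
      · exact Or.inl rfl
      · exact Or.inr h.symm
    · rintro x y z (rfl | h) (rfl | h')
      · exact Or.inl rfl
      · exact Or.inr h'
      · exact Or.inr h
      · exact Or.inl (h.left_unique h'.symm)

/-- The contraction `W · e`: remove the edge `e` and identify its two ends. -/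
def contractEdge (W : Graph α β) (e : β) : Graph (Quotient (endsSetoid W e)) β :=
  (W.deleteEdges {e}).map (Quotient.mk (endsSetoid W e))

end Graphs

/-! ### Classical states and classical reliability -/

section Classical

variable {α β : Type*}

/-- The set `{0,1}^E` of classical states on a set `E` of edges. -/
def CState (E : Set β) : Type _ := ↥E → Bool

instance [Finite β] (E : Set β) : Finite (CState E) := inferInstanceAs (Finite (↥E → Bool))

noncomputable instance [Finite β] (E : Set β) : Fintype (CState E) := Fintype.ofFinite _

noncomputable instance [Finite β] (E : Set β) : Fintype ↥E := Fintype.ofFinite _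

noncomputable instance (E : Set β) : DecidableEq (CState E) := Classical.decEq _

/-- The restriction of a classical state to a subset of the edges. -/
def CState.restrict {E F : Set β} (h : F ⊆ E) (ε : CState E) : CState F :=
  fun e => ε ⟨e.1, h e.2⟩

/-- The graph `W(ε)`: the edges of `W` in state zero are removed, all vertices are kept. -/
def stateGraph (W : Graph α β) (ε : CState E(W)) : Graph α β :=
  W.restrict {e | ∃ h : e ∈ E(W), ε ⟨e, h⟩ = true}

/-- A classical state `ε` of `W` is connected if the graph `W(ε)` is. -/
def IsConnectedState (W : Graph α β) (ε : CState E(W)) : Prop :=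
  IsConnected (stateGraph W ε)

/-- The probability of the state `ε` when the edges are independent Bernoulli variables with
parameters `p e`. -/
noncomputable def stateProb [Finite β] {E : Set β} (p : β → ℝ) (ε : CState E) : ℝ :=
  ∏ e : ↥E, if ε e = true then p e else 1 - p e

open Classical in
/-- The classical reliability `R_W(p)` of the stochastic graph with parameters `p e`, `e ∈ E(W)`
(values of `p` outside `E(W)` play no role): the probability of being connected. -/
noncomputable def reliability [Finite β] (W : Graph α β) (p : β → ℝ) : ℝ :=
  ∑ ε : CState E(W), if IsConnectedState W ε then stateProb p ε else 0

/-- The decomposition `Λ_G = Λ_K × Λ_H` for a disjoint union of edge sets. -/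
noncomputable def splitState {E F F' : Set β} (h : E = F ∪ F') (hd : Disjoint F F') :
    CState E ≃ CState F × CState F' where
  toFun ε := (ε.restrict (h ▸ Set.subset_union_left), ε.restrict (h ▸ Set.subset_union_right))
  invFun a := by
    classical
    exact fun e => if he : e.1 ∈ F then a.1 ⟨e.1, he⟩ else
      a.2 ⟨e.1, (show e.1 ∈ F ∪ F' from h ▸ e.2).resolve_left he⟩
  left_inv ε := by
    funext e
    by_cases he : e.1 ∈ F <;> simp [he, CState.restrict]
  right_inv a := by
    refine Prod.ext ?_ ?_
    · funext e
      simp [CState.restrict]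
    · funext e
      have he : e.1 ∉ F := fun h' => Set.disjoint_left.1 hd h' e.2
      simp [CState.restrict, he]

end Classical

/-! ### Quantum states -/

section Quantum

variable {α β : Type*} [Finite β]

/-- The Hermitian space `l²_ℂ(Λ)` on the classical states. -/
abbrev Hilb (E : Set β) : Type _ := EuclideanSpace ℂ (CState E)

/-- The unit sphere of `l²_ℂ(Λ)`. -/
abbrev Sph (E : Set β) : Type _ := Metric.sphere (0 : Hilb E) 1

/-- The set of quantum states `qΛ = S / U(1)`: the orbits of the unit sphere under multiplication by
global phases. -/
noncomputable abbrev QState (E : Set β) : Type _ :=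
  MulAction.orbitRel.Quotient (Metric.sphere (0 : ℂ) 1) (Sph E)

/-- The projection `π : S → qΛ`. -/
noncomputable def toQ {E : Set β} (ψ : Sph E) : QState E := Quotient.mk _ ψ

/-- The basis vector `|ε⟩`. -/
noncomputable def ket {E : Set β} (ε : CState E) : Hilb E := EuclideanSpace.single ε 1

lemma mem_sphere_iff_sum {E : Set β} (v : Hilb E) :
    v ∈ Metric.sphere (0 : Hilb E) 1 ↔ ∑ ε, ‖v ε‖ ^ 2 = 1 := by
  rw [mem_sphere_zero_iff_norm, ← EuclideanSpace.norm_sq_eq]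
  constructor
  · intro h
    simp [h]
  · intro h
    have := norm_nonneg v
    nlinarith

/-- The tensor product `|ψ_K⟩ ⊗ |ψ_H⟩` of unit vectors, as a unit vector of `l²(Λ_G)`, through the
identification `l²(Λ_K) ⊗ l²(Λ_H) = l²(Λ_K × Λ_H) = l²(Λ_G)`. -/
noncomputable def tensor {G K H : Graph α β} (h : IsUnionOf G K H) (ψK : Sph E(K)) (ψH : Sph E(H)) :
    Sph E(G) :=
  ⟨WithLp.toLp 2 fun ε =>
      ψK.1 (ε.restrict h.left_le.edgeSet_mono) * ψH.1 (ε.restrict h.right_le.edgeSet_mono), by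
    rw [mem_sphere_iff_sum]
    have hK := (mem_sphere_iff_sum ψK.1).1 ψK.2
    have hH := (mem_sphere_iff_sum ψH.1).1 ψH.2
    rw [← (splitState h.edgeSet_eq h.edgeSet_disjoint).symm.sum_comp, Fintype.sum_prod_type]
    have key : ∀ (a : CState E(K)) (b : CState E(H)),
        ‖ψK.1 (((splitState h.edgeSet_eq h.edgeSet_disjoint).symm (a, b)).restrict
            h.left_le.edgeSet_mono)
          * ψH.1 (((splitState h.edgeSet_eq h.edgeSet_disjoint).symm (a, b)).restrict
            h.right_le.edgeSet_mono)‖ ^ 2 = ‖ψK.1 a‖ ^ 2 * ‖ψH.1 b‖ ^ 2 := by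
      intro a b
      have hab := (splitState h.edgeSet_eq h.edgeSet_disjoint).apply_symm_apply (a, b)
      have ha : ((splitState h.edgeSet_eq h.edgeSet_disjoint).symm (a, b)).restrict
          h.left_le.edgeSet_mono = a := congrArg Prod.fst hab
      have hb : ((splitState h.edgeSet_eq h.edgeSet_disjoint).symm (a, b)).restrict
          h.right_le.edgeSet_mono = b := congrArg Prod.snd hab
      rw [norm_mul, mul_pow, ha, hb]
    simp only [key]
    simp only [← Finset.mul_sum, hH, mul_one, hK]⟩

/-- The coefficient at `b` of the qubit `p^{1/2} |1⟩ + (1-p)^{1/2} z |0⟩`. -/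
noncomputable def qubitCoeff (p : ℝ) (z : ℂ) (b : Bool) : ℂ :=
  if b = true then (Real.sqrt p : ℂ) else (Real.sqrt (1 - p) : ℂ) * z

/-- The non entangled unit vector
`⨂_{e ∈ E} ((p e)^{1/2} |1_e⟩ + (1 - p e)^{1/2} (z e) |0_e⟩)`. -/
noncomputable def productState (E : Set β) (p : β → ℝ) (z : β → ℂ)
    (hp : ∀ e, p e ∈ Set.Icc (0 : ℝ) 1) (hz : ∀ e, ‖z e‖ = 1) : Sph E :=
  ⟨WithLp.toLp 2 fun ε => ∏ e : ↥E, qubitCoeff (p e) (z e) (ε e), by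
    rw [mem_sphere_iff_sum]
    classical
    have h1 : ∀ e : ↥E, ∑ b : Bool, ‖qubitCoeff (p e) (z e) b‖ ^ 2 = 1 := by
      intro e
      have h0 := (hp e).1
      have h2 : 0 ≤ 1 - p e := by linarith [(hp e).2]
      simp [qubitCoeff, hz, Real.sq_sqrt h0, Real.sq_sqrt h2]
    have h3 := Finset.prod_univ_sum (fun _ : ↥E => (Finset.univ : Finset Bool))
      (fun e b => ‖qubitCoeff (p e) (z e) b‖ ^ 2)
    simp only [h1, Finset.prod_const_one] at h3
    rw [h3]
    simp only [norm_prod, Finset.prod_pow]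
    symm
    refine Finset.sum_bij (fun ε _ => (ε : CState E)) ?_ ?_ ?_ ?_
    · intros; exact Finset.mem_univ _
    · intro a _ b _ hab; exact hab
    · intro b _; exact ⟨b, Fintype.mem_piFinset.2 fun _ => Finset.mem_univ _, rfl⟩
    · intro a _; rfl⟩

/-- The function induced on quantum states by an operator: `π(|ψ⟩) ↦ ⟨ψ| L |ψ⟩`
(which is real for a self adjoint `L`). -/
noncomputable def inducedFun {E : Set β} (L : Hilb E →L[ℂ] Hilb E) : QState E → ℝ :=
  Quotient.lift (fun ψ : Sph E => (inner ℂ (ψ : Hilb E) (L (ψ : Hilb E))).re) (by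
    rintro a b ⟨c, rfl⟩
    have hc : ‖(c : ℂ)‖ = 1 := mem_sphere_zero_iff_norm.1 c.2
    have h : ((c • b : Sph E) : Hilb E) = (c : ℂ) • (b : Hilb E) := rfl
    have hcc : (c : ℂ) * (starRingEnd ℂ) (c : ℂ) = 1 := by
      rw [Complex.mul_conj, Complex.normSq_eq_norm_sq, hc]; simp
    simp only [h, map_smul, inner_smul_left, inner_smul_right]
    rw [← mul_assoc, hcc, one_mul])

/-- A quantum reliability on `W`: a smooth `[0,1]`-valued function on the quantum states satisfying
the extension axiom and the entanglement axiom. A function on `S / U(1)` is smooth if and only if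
its pullback to the sphere `S` is, that is, if the pullback is the restriction of a smooth function
on the ambient space. -/
structure IsQuantumReliability (W : Graph α β) (f : QState E(W) → ℝ) : Prop where
  smooth : ∃ F : Hilb E(W) → ℝ,
    ContDiff ℝ ((⊤ : ℕ∞) : WithTop ℕ∞) F ∧ ∀ ψ : Sph E(W), F ψ = f (toQ ψ)
  mem_Icc : ∀ ζ, f ζ ∈ Set.Icc (0 : ℝ) 1
  extension : ∀ (p : β → ℝ) (z : β → ℂ) (hp : ∀ e, p e ∈ Set.Icc (0 : ℝ) 1) (hz : ∀ e, ‖z e‖ = 1),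
    f (toQ (productState E(W) p z hp hz)) = reliability W p
  entanglement : ∀ ζ χ : CState E(W), IsConnectedState W ζ → ¬ IsConnectedState W χ →
    ∀ p ∈ Set.Icc (0 : ℝ) 1, ∀ z : ℂ, ‖z‖ = 1 → ∀ ψ : Sph E(W),
      (ψ : Hilb E(W)) = (Real.sqrt p : ℂ) • ket ζ + ((Real.sqrt (1 - p) : ℂ) * z) • ket χ →
      f (toQ ψ) = p

open Classical in
/-- The quantum reliability operator of `W`: the orthogonal projection onto the span of the `|ε⟩`
with `ε` a connected state. -/
noncomputable def qrOperator (W : Graph α β) : Hilb E(W) →L[ℂ] Hilb E(W) :=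
  LinearMap.toContinuousLinearMap
    { toFun := fun ψ => WithLp.toLp 2 fun ε => if IsConnectedState W ε then ψ ε else 0
      map_add' := by
        intro x y
        ext ε
        by_cases h : IsConnectedState W ε <;> simp [h]
      map_smul' := by
        intro c x
        ext ε
        by_cases h : IsConnectedState W ε <;> simp [h] }

/-- `L` is the unique self adjoint operator whose induced function is a quantum reliability on
`W`. -/
def IsUniqueQROperator (W : Graph α β) (L : Hilb E(W) →L[ℂ] Hilb E(W)) : Prop :=
  (IsSelfAdjoint L ∧ IsQuantumReliability W (inducedFun L)) ∧
    ∀ L' : Hilb E(W) →L[ℂ] Hilb E(W),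
      IsSelfAdjoint L' → IsQuantumReliability W (inducedFun L') → L' = L

/-- The quantum reliability `QR_W` induced by the quantum reliability operator. -/
noncomputable def QR (W : Graph α β) : QState E(W) → ℝ := inducedFun (qrOperator W)

end Quantum

/-! ### The connectivity matrix -/

section Connectivity

variable {α : Type*}

instance [Finite α] (U : Set α) : Finite (Setoid U) :=
  Finite.of_injective (fun γ : Setoid U => fun x y => γ x y)
    (fun _ _ h => Setoid.ext fun x y => iff_of_eq (congrFun (congrFun h x) y))

noncomputable instance [Finite α] (U : Set α) : Fintype (Setoid U) := Fintype.ofFinite _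

noncomputable instance (U : Set α) : DecidableEq (Setoid U) := Classical.decEq _

open Classical in
/-- The connectivity matrix on the partitions of `U` (as equivalence relations): the entry is one if
the finest common coarsening of `γ` and `γ'` has a single class, and zero otherwise. For the order
in which finer partitions are larger this coarsening is the infimum; Mathlib's order on `Setoid` is
the opposite one. -/
noncomputable def connMatrix (U : Set α) : Matrix (Setoid U) (Setoid U) ℝ :=
  Matrix.of fun γ γ' => if Nat.card (Quotient (γ ⊔ γ')) = 1 then 1 else 0

/-- The coefficients `β_{γ,γ'}`: the entries of the inverse of the connectivity matrix. -/
noncomputable def splitCoeff [Finite α] (U : Set α) : Matrix (Setoid U) (Setoid U) ℝ :=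
  (connMatrix U)⁻¹

end Connectivity

end QNet

/-!
A state `ε` of `G = K ∪ H` is connected exactly when every component of `K(ε)` and of `H(ε)` meets
the set `U` of shared vertices and the two partitions which these components induce on `U` have a
one-class join (`isConnectedState_union_iff`). Likewise a state of `K / γ` is connected exactly when
all components of `K(ε)` meet `U` and the induced partition has a one-class join with `γ`
(`isConnectedState_identify_iff`). Both are instances of a gluing criterion for equivalence relations
(`forall_sup_rel_iff`). So, with `A` the connectivity matrix, the indicators of connectedness in
`G`, `K / γ`, `H / γ'` are, up to common factors, entries of `A`, and the splitting formula for them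
is an entry of `A * A⁻¹ * A = A` (`connIndicator_union`). The reliability and the quantum reliability
of a product vector are sums of these indicators against weights that factorize over `K` and `H`.

`A` is invertible (`isUnit_det_connMatrix`) because it is `Z * D * Zᵀ` with `Z` the zeta matrix of
the partition lattice and `D` diagonal. The entry of `D` at a partition with `k` classes is the
linear coefficient of `X (X - 1) ⋯ (X - k + 1)`, which is not zero; the factorization compares linear
coefficients in `X ^ #x = ∑_{w ≥ x} X (X - 1) ⋯ (X - #w + 1)`, which counts functions by their
kernels.

The projection onto the connected states is the only operator inducing a quantum reliability
(`isUniqueQROperator_qrOperator`): such an operator `L` satisfies `0 ≤ L ≤ 1`, and the extension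
axiom at parameters in `{0, 1}` makes its diagonal the indicator of the connected states. A positive
operator kills each vector on which its form vanishes, so applying this to `L` and `1 - L` determines
`L` on the basis.
-/

namespace QNet

/-! ### Equivalence relations glued along a set -/

section Gluing

variable {α : Type*}

lemma sup_rel_iff_reflTransGen (s t : Setoid α) (x y : α) :
    (s ⊔ t) x y ↔ Relation.ReflTransGen (fun a b => s a b ∨ t a b) x y := by
  have hs : Std.Symm (fun a b => s a b ∨ t a b) :=
    ⟨fun a b h => h.imp s.symm' t.symm'⟩
  rw [Setoid.sup_eq_eqvGen, ← Relation.EqvGen.eqvGen_eq_reflTransGen]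
  rfl

/-- The restriction of an equivalence relation to the elements of `U`. -/
abbrev trace (U : Set α) (s : Setoid α) : Setoid U := s.comap Subtype.val

/-- If `s` is trivial outside `A` and `t` is trivial outside `B`, a class of `s ⊔ t` which contains
an element of `A` and an element of `A ∩ B` contains an element of `A ∩ B` that is already `s`-related
to the first one: a chain can only leave `A` through `A ∩ B`. -/
lemma exists_rel_of_sup_rel {A B : Set α} {s t : Setoid α}
    (ht : ∀ x y, t x y → x = y ∨ x ∈ B ∧ y ∈ B) (hs : ∀ x y, s x y → x = y ∨ x ∈ A ∧ y ∈ A)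
    {x u : α} (hx : x ∈ A) (hu : u ∈ A ∩ B) (h : (s ⊔ t) x u) : ∃ v ∈ A ∩ B, s x v := by
  by_contra hcon
  push Not at hcon
  replace h := (sup_rel_iff_reflTransGen s t x u).1 h
  have key : ∀ z, Relation.ReflTransGen (fun a b => s a b ∨ t a b) x z → s x z := by
    intro z hz
    induction hz with
    | refl => exact s.refl' x
    | @tail y z _ hyz hy =>
      rcases hyz with hyz | hyz
      · exact s.trans' hy hyz
      · rcases ht _ _ hyz with rfl | ⟨hyB, -⟩
        · exact hy
        · have hyA : y ∈ A := by
            rcases hs _ _ hy with rfl | ⟨-, h⟩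
            exacts [hx, h]
          exact absurd hy (hcon y ⟨hyA, hyB⟩)
  exact hcon u hu (key u h)

/-- On `A ∩ B`, the join of a relation living on `A` and a relation living on `B` is the join of the
restrictions. -/
lemma trace_sup {A B : Set α} {s t : Setoid α}
    (hs : ∀ x y, s x y → x = y ∨ x ∈ A ∧ y ∈ A) (ht : ∀ x y, t x y → x = y ∨ x ∈ B ∧ y ∈ B) :
    trace (A ∩ B) (s ⊔ t) = trace (A ∩ B) s ⊔ trace (A ∩ B) t := by
  apply le_antisymm
  · rintro u w h
    have h' := (sup_rel_iff_reflTransGen s t u.1 w.1).1 h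
    have key : ∀ y, Relation.ReflTransGen (fun a b => s a b ∨ t a b) u.1 y →
        ∃ v : ↥(A ∩ B), (trace (A ∩ B) s ⊔ trace (A ∩ B) t) u v ∧ (s v y ∨ t v y) := by
      intro y hy
      have hmem : ∀ (v : ↥(A ∩ B)) (y : α), s v y → y ∈ A := by
        intro v y hv
        rcases hs _ _ hv with h | ⟨-, h⟩
        exacts [h ▸ v.2.1, h]
      have hmem' : ∀ (v : ↥(A ∩ B)) (y : α), t v y → y ∈ B := by
        intro v y hv
        rcases ht _ _ hv with h | ⟨-, h⟩
        exacts [h ▸ v.2.2, h]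
      induction hy with
      | refl => exact ⟨u, Setoid.refl' _ u, Or.inl (s.refl' _)⟩
      | @tail y z _ hyz ih =>
        obtain ⟨v, huv, hv⟩ := ih
        rcases hv with hv | hv <;> rcases hyz with hyz | hyz
        · exact ⟨v, huv, Or.inl (s.trans' hv hyz)⟩
        · rcases ht _ _ hyz with rfl | ⟨hyB, -⟩
          · exact ⟨v, huv, Or.inl hv⟩
          · refine ⟨⟨y, hmem v y hv, hyB⟩, Setoid.trans' _ huv ?_, Or.inr hyz⟩
            exact (le_sup_left : trace (A ∩ B) s ≤ _) hv
        · rcases hs _ _ hyz with rfl | ⟨hyA, -⟩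
          · exact ⟨v, huv, Or.inr hv⟩
          · refine ⟨⟨y, hyA, hmem' v y hv⟩, Setoid.trans' _ huv ?_, Or.inl hyz⟩
            exact (le_sup_right : trace (A ∩ B) t ≤ _) hv
        · exact ⟨v, huv, Or.inr (t.trans' hv hyz)⟩
    obtain ⟨v, huv, hv | hv⟩ := key w.1 h'
    · exact Setoid.trans' _ huv ((le_sup_left : trace (A ∩ B) s ≤ _) hv)
    · exact Setoid.trans' _ huv ((le_sup_right : trace (A ∩ B) t ≤ _) hv)
  · refine sup_le ?_ ?_
    · intro u w h
      exact (le_sup_left : s ≤ s ⊔ t) h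
    · intro u w h
      exact (le_sup_right : t ≤ s ⊔ t) h

/-- Gluing criterion: `s ⊔ t` relates all of `A ∪ B` if and only if every element of `A` is
`s`-related to the overlap `A ∩ B`, every element of `B` is `t`-related to it, and the restrictions
of `s` and `t` generate the full relation on the overlap. -/
lemma forall_sup_rel_iff {A B : Set α} {s t : Setoid α}
    (hs : ∀ x y, s x y → x = y ∨ x ∈ A ∧ y ∈ A) (ht : ∀ x y, t x y → x = y ∨ x ∈ B ∧ y ∈ B)
    (hne : (A ∩ B).Nonempty) :
    (∀ x ∈ A ∪ B, ∀ y ∈ A ∪ B, (s ⊔ t) x y) ↔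
      (∀ x ∈ A, ∃ u ∈ A ∩ B, s x u) ∧ (∀ x ∈ B, ∃ u ∈ A ∩ B, t x u) ∧
        trace (A ∩ B) s ⊔ trace (A ∩ B) t = ⊤ := by
  obtain ⟨u₀, hu₀⟩ := hne
  rw [← trace_sup hs ht, Setoid.eq_top_iff]
  constructor
  · intro h
    refine ⟨fun x hx => exists_rel_of_sup_rel ht hs hx hu₀ (h x (Or.inl hx) u₀ (Or.inl hu₀.1)),
      fun x hx => ?_, fun u v => h u (Or.inl u.2.1) v (Or.inl v.2.1)⟩
    have h' := h x (Or.inr hx) u₀ (Or.inl hu₀.1)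
    rw [sup_comm] at h'
    rw [Set.inter_comm]
    exact exists_rel_of_sup_rel hs ht hx ⟨hu₀.2, hu₀.1⟩ h'
  · rintro ⟨hA, hB, hU⟩
    have key : ∀ x ∈ A ∪ B, ∃ u ∈ A ∩ B, (s ⊔ t) x u := by
      rintro x (hx | hx)
      · obtain ⟨u, hu, h⟩ := hA x hx
        exact ⟨u, hu, (le_sup_left : s ≤ s ⊔ t) h⟩
      · obtain ⟨u, hu, h⟩ := hB x hx
        exact ⟨u, hu, (le_sup_right : t ≤ s ⊔ t) h⟩
    intro x hx y hy
    obtain ⟨u, hu, hxu⟩ := key x hx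
    obtain ⟨v, hv, hyv⟩ := key y hy
    exact Setoid.trans' _ hxu (Setoid.trans' _ (hU ⟨u, hu⟩ ⟨v, hv⟩) (Setoid.symm' _ hyv))

lemma card_quotient_eq_one_iff {β : Type*} [Nonempty β] (s : Setoid β) :
    Nat.card (Quotient s) = 1 ↔ s = ⊤ := by
  rw [Nat.card_eq_one_iff_unique, Quotient.subsingleton_iff]
  exact and_iff_left (Nonempty.map (Quotient.mk s) ‹_›)

end Gluing

/-! ### Connected states of glued graphs -/

section Paths

variable {α β : Type*}

/-- The equivalence relation on all vertices of being joined by a path of `W`. Elements outside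
`V(W)` are related to themselves only. -/
def pathSetoid (W : Graph α β) : Setoid α where
  r := Relation.ReflTransGen W.Adj
  iseqv := ⟨fun _ => .refl, fun h => (Relation.ReflTransGen.stdSymm (r := W.Adj)).symm _ _ h,
    fun h h' => h.trans h'⟩

lemma isConnected_iff (W : Graph α β) :
    IsConnected W ↔ V(W).Nonempty ∧ ∀ x ∈ V(W), ∀ y ∈ V(W), pathSetoid W x y := Iff.rfl

lemma pathSetoid_le_iff {W : Graph α β} {s : Setoid α} :
    pathSetoid W ≤ s ↔ ∀ x y, W.Adj x y → s x y := by
  refine ⟨fun h x y hxy => h (Relation.ReflTransGen.single hxy), fun h x y hxy => ?_⟩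
  induction (hxy : Relation.ReflTransGen W.Adj x y) with
  | refl => exact s.refl' x
  | tail _ h2 ih => exact s.trans' ih (h _ _ h2)

lemma pathSetoid_of_adj {W : Graph α β} {x y : α} (h : W.Adj x y) : pathSetoid W x y :=
  Relation.ReflTransGen.single h

lemma eq_or_mem_of_pathSetoid {W : Graph α β} {x y : α} (h : pathSetoid W x y) :
    x = y ∨ x ∈ V(W) ∧ y ∈ V(W) := by
  induction (h : Relation.ReflTransGen W.Adj x y) with
  | refl => exact Or.inl rfl
  | tail _ h2 ih =>
    rcases ih with rfl | ⟨h, -⟩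
    · exact Or.inr ⟨h2.left_mem, h2.right_mem⟩
    · exact Or.inr ⟨h, h2.right_mem⟩

/-- Two vertices of `W` become joined after the identifications made by `f` exactly when they are
related by the join of "joined in `W`" and "identified by `f`". -/
lemma comap_pathSetoid_map {α' : Type*} (W : Graph α β) (f : α → α') :
    (pathSetoid (W.map f)).comap f = pathSetoid W ⊔ Setoid.ker f := by
  apply le_antisymm
  · intro x y h
    have key : ∀ b, Relation.ReflTransGen (W.map f).Adj (f x) b →
        ∀ y, f y = b → (pathSetoid W ⊔ Setoid.ker f) x y := by
      intro b hb
      induction hb with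
      | refl => exact fun y hy => (le_sup_right : Setoid.ker f ≤ _) hy.symm
      | tail _ hbc ih =>
        intro y hy
        rw [Graph.map_adj] at hbc
        obtain ⟨a, a', haa, hab, hac⟩ := hbc
        exact Setoid.trans' _ (ih a hab) (Setoid.trans' _
          ((le_sup_left : pathSetoid W ≤ _) (pathSetoid_of_adj haa))
          ((le_sup_right : Setoid.ker f ≤ _) (hac.trans hy.symm)))
    exact key _ h y rfl
  · refine sup_le (pathSetoid_le_iff.2 fun x y h => ?_) fun x y h => ?_
    · exact pathSetoid_of_adj (h.map f)
    · have h' : f x = f y := h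
      rw [Setoid.comap_rel, h']

lemma isConnected_map_iff {α' : Type*} (W : Graph α β) (f : α → α') :
    IsConnected (W.map f) ↔
      V(W).Nonempty ∧ ∀ x ∈ V(W), ∀ y ∈ V(W), (pathSetoid W ⊔ Setoid.ker f) x y := by
  rw [← comap_pathSetoid_map, isConnected_iff]
  simp [Setoid.comap_rel]

lemma stateGraph_map {α' : Type*} (W : Graph α β) (f : α → α') (ε : CState E(W)) :
    stateGraph (W.map f) ε = (stateGraph W ε).map f := by
  refine Graph.ext rfl fun e x y => ?_
  constructor
  · rintro ⟨he, a, b, hab, rfl, rfl⟩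
    exact ⟨a, b, ⟨he, hab⟩, rfl, rfl⟩
  · rintro ⟨a, b, ⟨he, hab⟩, rfl, rfl⟩
    exact ⟨he, a, b, hab, rfl, rfl⟩

/-- Every vertex of `W` is joined in `W(ε)` to a vertex of `U`. -/
def ReachesSet (W : Graph α β) (U : Set α) (ε : CState E(W)) : Prop :=
  ∀ x ∈ V(W), ∃ u ∈ U, pathSetoid (stateGraph W ε) x u

/-- The partition of `U` induced by the connected components of `W(ε)`. -/
def boundaryPartition (W : Graph α β) (U : Set α) (ε : CState E(W)) : Setoid U :=
  trace U (pathSetoid (stateGraph W ε))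

lemma ker_mk_identSetoid {U : Set α} (γ : Setoid U) :
    Setoid.ker (Quotient.mk (identSetoid γ)) = identSetoid γ :=
  Setoid.ker_mk_eq _

lemma trace_identSetoid {U : Set α} (γ : Setoid U) : trace U (identSetoid γ) = γ := by
  ext x y
  constructor
  · rintro (h | ⟨_, _, h⟩)
    · rw [Subtype.ext h]
    · exact h
  · exact fun h => Or.inr ⟨x.2, y.2, h⟩

/-- A state of `W / γ` is connected if and only if every component of `W(ε)` meets `U` and the
partition of `U` induced by `W(ε)` has a one-class join with `γ`. -/
lemma isConnectedState_identify_iff (W : Graph α β) {U : Set α} (hU : U ⊆ V(W)) (hne : U.Nonempty)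
    (γ : Setoid U) (ε : CState E(W)) :
    IsConnectedState (identify W γ) ε ↔
      ReachesSet W U ε ∧ Nat.card (Quotient (boundaryPartition W U ε ⊔ γ)) = 1 := by
  have := hne.to_subtype
  rw [card_quotient_eq_one_iff]
  have h1 : IsConnectedState (identify W γ) ε ↔
      IsConnected ((stateGraph W ε).map (Quotient.mk (identSetoid γ))) := by
    rw [← stateGraph_map]; rfl
  have hV : V(stateGraph W ε) = V(W) := rfl
  have h2 := forall_sup_rel_iff (s := pathSetoid (stateGraph W ε)) (t := identSetoid γ)
    (A := V(W)) (B := U) (fun x y => eq_or_mem_of_pathSetoid (W := stateGraph W ε))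
    (fun x y h => h.imp_right fun ⟨hx, hy, _⟩ => ⟨hx, hy⟩)
    (by rwa [Set.inter_eq_self_of_subset_right hU])
  rw [Set.inter_eq_self_of_subset_right hU, Set.union_eq_self_of_subset_right hU,
    trace_identSetoid] at h2
  rw [h1, isConnected_map_iff, ker_mk_identSetoid, hV, h2]
  refine ⟨fun h => ⟨h.2.1, h.2.2.2⟩, fun h => ⟨hne.mono hU, h.1, ?_, h.2⟩⟩
  exact fun x hx => ⟨x, hx, Setoid.refl' _ x⟩

/-- The edges present in a state of the union are those present in its two restrictions. -/
lemma pathSetoid_stateGraph_union {G K H : Graph α β} (h : IsUnionOf G K H) (ε : CState E(G)) :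
    pathSetoid (stateGraph G ε) =
      pathSetoid (stateGraph K (ε.restrict h.left_le.edgeSet_mono)) ⊔
        pathSetoid (stateGraph H (ε.restrict h.right_le.edgeSet_mono)) := by
  apply le_antisymm
  · refine pathSetoid_le_iff.2 fun x y hxy => ?_
    obtain ⟨e, ⟨he, hε⟩, hl⟩ := hxy
    rcases (h.edgeSet_eq ▸ he : e ∈ E(K) ∪ E(H)) with heK | heH
    · exact (le_sup_left : pathSetoid (stateGraph K _) ≤ _)
        (pathSetoid_of_adj ⟨e, ⟨heK, hε⟩, (h.left_le.isLink_iff heK).2 hl⟩)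
    · exact (le_sup_right : pathSetoid (stateGraph H _) ≤ _)
        (pathSetoid_of_adj ⟨e, ⟨heH, hε⟩, (h.right_le.isLink_iff heH).2 hl⟩)
  · refine sup_le (pathSetoid_le_iff.2 fun x y hxy => ?_) (pathSetoid_le_iff.2 fun x y hxy => ?_)
    · obtain ⟨e, ⟨he, hε⟩, hl⟩ := hxy
      exact pathSetoid_of_adj ⟨e, ⟨h.left_le.edgeSet_mono he, hε⟩, hl.mono h.left_le⟩
    · obtain ⟨e, ⟨he, hε⟩, hl⟩ := hxy
      exact pathSetoid_of_adj ⟨e, ⟨h.right_le.edgeSet_mono he, hε⟩, hl.mono h.right_le⟩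

/-- A state of `G = K ∪ H` is connected if and only if all components of its two restrictions meet
the shared vertices and the two induced partitions of these have a one-class join. -/
lemma isConnectedState_union_iff {G K H : Graph α β} (h : IsUnionOf G K H)
    (hne : (V(K) ∩ V(H)).Nonempty) (ε : CState E(G)) :
    IsConnectedState G ε ↔
      ReachesSet K (V(K) ∩ V(H)) (ε.restrict h.left_le.edgeSet_mono) ∧
      ReachesSet H (V(K) ∩ V(H)) (ε.restrict h.right_le.edgeSet_mono) ∧
      Nat.card (Quotient
        (boundaryPartition K (V(K) ∩ V(H)) (ε.restrict h.left_le.edgeSet_mono) ⊔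
          boundaryPartition H (V(K) ∩ V(H)) (ε.restrict h.right_le.edgeSet_mono))) = 1 := by
  have := hne.to_subtype
  rw [card_quotient_eq_one_iff]
  have hV : V(stateGraph G ε) = V(K) ∪ V(H) := h.vertexSet_eq
  rw [IsConnectedState, isConnected_iff, hV, pathSetoid_stateGraph_union h]
  refine (and_iff_right ?_).trans (forall_sup_rel_iff (A := V(K)) (B := V(H))
    (fun x y => eq_or_mem_of_pathSetoid (W := stateGraph K _))
    (fun x y => eq_or_mem_of_pathSetoid (W := stateGraph H _)) hne)
  exact hne.mono fun x hx => Or.inl hx.1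

end Paths

/-! ### Invertibility of the connectivity matrix -/

section ConnMatrix

/-- The functions on `X` with kernel `w` are the injections from the set of classes of `w`. -/
def kerFiberEquiv {X Y : Type*} (w : Setoid X) :
    {f : X → Y // Setoid.ker f = w} ≃ (Quotient w ↪ Y) where
  toFun f := ⟨Quotient.lift f.1 fun a b h => by
      have h' : w a b := h
      rw [← f.2] at h'
      exact h', by
    rintro ⟨a⟩ ⟨b⟩ h
    refine Quotient.sound ?_
    change w a b
    rw [← f.2]
    exact h⟩
  invFun g := ⟨fun a => g (Quotient.mk w a), by
    ext a b
    rw [Setoid.ker_def, g.injective.eq_iff, Quotient.eq]⟩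
  left_inv f := rfl
  right_inv g := by
    ext ⟨a⟩
    rfl

lemma sum_descFactorial_card_quotient {X : Type*} [Finite X] [Fintype (Setoid X)]
    [DecidableLE (Setoid X)] (x : Setoid X) (n : ℕ) :
    ∑ w with x ≤ w, n.descFactorial (Nat.card (Quotient w)) = n ^ Nat.card (Quotient x) := by
  classical
  have := Fintype.ofFinite X
  have h1 : Nat.card (Quotient x → Fin n) = n ^ Nat.card (Quotient x) := by
    simp
  rw [← h1, ← Nat.card_congr (Setoid.liftEquiv x (β := Fin n)), Nat.card_eq_fintype_card,
    Fintype.card_subtype, Finset.card_eq_sum_card_fiberwise (f := fun f => Setoid.ker f)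
      (t := Finset.univ.filter fun w => x ≤ w) (fun f hf => by simpa using hf)]
  refine Finset.sum_congr rfl fun w hw => ?_
  have h2 : Nat.card (Quotient w ↪ Fin n) = n.descFactorial (Nat.card (Quotient w)) := by
    simp [Nat.card_eq_fintype_card]
  rw [← h2, ← Nat.card_congr (kerFiberEquiv w), Nat.card_eq_fintype_card, Fintype.card_subtype,
    Finset.filter_filter]
  congr 1
  ext f
  have hxw : x ≤ w := by simpa using hw
  simp only [Finset.mem_filter, Finset.mem_univ, true_and]
  exact ⟨fun h => ⟨h.symm ▸ hxw, h⟩, fun h => h.2⟩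

open Polynomial in
/-- Sorting the functions `X → Fin n` that are constant on the classes of `x` by their kernels
expands `n ^ #x` into falling factorials. -/
lemma sum_descPochhammer_card_quotient {X : Type*} [Finite X] [Fintype (Setoid X)]
    [DecidableLE (Setoid X)] (x : Setoid X) :
    ∑ w with x ≤ w, descPochhammer ℝ (Nat.card (Quotient w)) =
      (Polynomial.X : ℝ[X]) ^ Nat.card (Quotient x) := by
  refine Polynomial.eq_of_infinite_eval_eq _ _ ((Set.infinite_range_of_injective
    (Nat.cast_injective (R := ℝ))).mono ?_)
  rintro _ ⟨n, rfl⟩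
  simp only [Set.mem_ofPred_eq, eval_finsetSum, descPochhammer_eval_eq_descFactorial, eval_pow,
    eval_X]
  exact_mod_cast sum_descFactorial_card_quotient x n

lemma coeff_one_descPochhammer_ne_zero {k : ℕ} (hk : k ≠ 0) :
    (descPochhammer ℝ k).coeff 1 ≠ 0 := by
  obtain ⟨k, rfl⟩ := Nat.exists_eq_succ_of_ne_zero hk
  have h : ∀ m : ℕ, (descPochhammer ℝ m).eval (-1) ≠ 0 := by
    intro m
    induction m with
    | zero => simp
    | succ m ih =>
      rw [descPochhammer_succ_eval]
      refine mul_ne_zero ih ?_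
      have : (0 : ℝ) ≤ m := m.cast_nonneg
      linarith
  rw [Nat.succ_eq_add_one, descPochhammer_succ_left, ← zero_add 1, Polynomial.coeff_X_mul,
    Polynomial.coeff_zero_eq_eval_zero, Polynomial.eval_comp]
  simpa using h k

open Classical in
/-- The zeta matrix of the lattice of partitions of `U`. -/
noncomputable def zetaMatrix {α : Type*} (U : Set α) : Matrix (Setoid U) (Setoid U) ℝ :=
  Matrix.of fun γ w => if γ ≤ w then 1 else 0

lemma det_zetaMatrix_ne_zero {α : Type*} [Finite α] (U : Set α) : (zetaMatrix U).det ≠ 0 := by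
  classical
  intro h
  obtain ⟨v, hv, hZ⟩ := Matrix.exists_mulVec_eq_zero_iff.2 h
  refine hv (funext fun γ => ?_)
  induction γ using WellFoundedGT.induction with
  | ind γ ih =>
    have h1 := congrFun hZ γ
    simp only [Matrix.mulVec, dotProduct, zetaMatrix, Matrix.of_apply, ite_mul, one_mul, zero_mul,
      Pi.zero_apply] at h1
    rw [Finset.sum_eq_single γ] at h1
    · simpa using h1
    · intro w _ hw
      split_ifs with hle
      · exact ih w (lt_of_le_of_ne hle (Ne.symm hw))
      · rfl
    · simp

/-- The linear coefficients of the falling factorials, which play the role of the Möbius function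
`μ(w, ⊤)`, diagonalize the connectivity matrix. -/
lemma connMatrix_eq {α : Type*} [Finite α] (U : Set α) :
    connMatrix U = zetaMatrix U *
      Matrix.diagonal (fun w => (descPochhammer ℝ (Nat.card (Quotient w))).coeff 1) *
        (zetaMatrix U).transpose := by
  classical
  ext γ γ'
  have h := congrArg (fun q => Polynomial.coeff q 1) (sum_descPochhammer_card_quotient (γ ⊔ γ'))
  simp only [Polynomial.finsetSum_coeff, Polynomial.coeff_X_pow] at h
  rw [Matrix.mul_apply]
  simp only [Matrix.mul_diagonal, connMatrix, Matrix.of_apply, zetaMatrix, Matrix.transpose_apply]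
  rw [Finset.sum_filter] at h
  simp only [eq_comm (a := (1 : ℕ))] at h
  rw [← h]
  refine Finset.sum_congr rfl fun w _ => ?_
  simp only [sup_le_iff]
  split_ifs <;> simp_all

lemma isUnit_det_connMatrix {α : Type*} [Finite α] {U : Set α} (hne : U.Nonempty) :
    IsUnit (connMatrix U).det := by
  have := hne.to_subtype
  rw [isUnit_iff_ne_zero, connMatrix_eq, Matrix.det_mul, Matrix.det_mul, Matrix.det_transpose,
    Matrix.det_diagonal]
  refine mul_ne_zero (mul_ne_zero (det_zetaMatrix_ne_zero U) ?_) (det_zetaMatrix_ne_zero U)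
  refine Finset.prod_ne_zero_iff.2 fun w _ => coeff_one_descPochhammer_ne_zero ?_
  have : Nonempty (Quotient w) := Nonempty.map (Quotient.mk w) ‹_›
  exact Nat.card_pos.ne'

end ConnMatrix

/-! ### Quantum reliability and its uniqueness -/

section Reliability

variable {α β : Type*}

open Classical in
/-- The indicator function of the connected states of `W`. -/
noncomputable def connIndicator (W : Graph α β) (ε : CState E(W)) : ℝ :=
  if IsConnectedState W ε then 1 else 0

lemma connIndicator_congr {α' : Type*} {W : Graph α β} {W' : Graph α' β} {ε : CState E(W)}
    {ε' : CState E(W')} (h : IsConnectedState W ε ↔ IsConnectedState W' ε') :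
    connIndicator W ε = connIndicator W' ε' := by
  classical
  rw [connIndicator, connIndicator]
  exact if_congr h rfl rfl

lemma connIndicator_mem_Icc (W : Graph α β) (ε : CState E(W)) :
    connIndicator W ε ∈ Set.Icc (0 : ℝ) 1 := by
  rw [connIndicator]
  split_ifs <;> simp

lemma ket_apply {E : Set β} (ε χ : CState E) : ket ε χ = if χ = ε then 1 else 0 := by
  simp [ket]

variable [Finite β]

lemma reliability_eq_sum (W : Graph α β) (p : β → ℝ) :
    reliability W p = ∑ ε, connIndicator W ε * stateProb p ε := by
  simp only [reliability, connIndicator, ite_mul, one_mul, zero_mul]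

lemma qrOperator_apply (W : Graph α β) (ψ : Hilb E(W)) (ε : CState E(W)) :
    qrOperator W ψ ε = (connIndicator W ε : ℂ) * ψ ε := by
  have h : qrOperator W ψ ε = @ite ℂ (IsConnectedState W ε) (Classical.propDecidable _) (ψ ε) 0 :=
    rfl
  rw [h, connIndicator]
  split_ifs <;> simp

lemma re_inner_qrOperator (W : Graph α β) (ψ : Hilb E(W)) :
    (inner ℂ ψ (qrOperator W ψ)).re = ∑ ε, connIndicator W ε * ‖ψ ε‖ ^ 2 := by
  rw [PiLp.inner_apply, Complex.re_sum]
  refine Finset.sum_congr rfl fun ε _ => ?_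
  rw [qrOperator_apply, RCLike.inner_apply, mul_assoc, Complex.mul_conj, ← Complex.ofReal_mul,
    Complex.ofReal_re, Complex.normSq_eq_norm_sq]

lemma QR_toQ (W : Graph α β) (ψ : Sph E(W)) :
    QR W (toQ ψ) = ∑ ε, connIndicator W ε * ‖ψ.1 ε‖ ^ 2 :=
  re_inner_qrOperator W ψ.1

lemma norm_sq_productState {E : Set β} (p : β → ℝ) (z : β → ℂ)
    (hp : ∀ e, p e ∈ Set.Icc (0 : ℝ) 1) (hz : ∀ e, ‖z e‖ = 1) (ε : CState E) :
    ‖(productState E p z hp hz).1 ε‖ ^ 2 = stateProb p ε := by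
  have h : (productState E p z hp hz).1 ε = ∏ e : ↥E, qubitCoeff (p e) (z e) (ε e) := rfl
  rw [h, norm_prod, ← Finset.prod_pow, stateProb]
  refine Finset.prod_congr rfl fun e _ => ?_
  have h0 := (hp e).1
  have h1 : 0 ≤ 1 - p e := by linarith [(hp e).2]
  by_cases hε : ε e = true <;>
    simp [qubitCoeff, hε, hz, Real.sq_sqrt h0, Real.sq_sqrt h1]

lemma QR_productState (W : Graph α β) (p : β → ℝ) (z : β → ℂ)
    (hp : ∀ e, p e ∈ Set.Icc (0 : ℝ) 1) (hz : ∀ e, ‖z e‖ = 1) :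
    QR W (toQ (productState E(W) p z hp hz)) = reliability W p := by
  rw [QR_toQ, reliability_eq_sum]
  simp only [norm_sq_productState]

lemma QR_mem_Icc (W : Graph α β) (ψ : Sph E(W)) : QR W (toQ ψ) ∈ Set.Icc (0 : ℝ) 1 := by
  rw [QR_toQ]
  have h := (mem_sphere_iff_sum ψ.1).1 ψ.2
  constructor
  · exact Finset.sum_nonneg fun ε _ => mul_nonneg (connIndicator_mem_Icc W ε).1 (sq_nonneg _)
  · exact (Finset.sum_le_sum fun ε _ =>
      mul_le_of_le_one_left (sq_nonneg _) (connIndicator_mem_Icc W ε).2).trans_eq h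

lemma isQuantumReliability_QR (W : Graph α β) : IsQuantumReliability W (QR W) where
  smooth := by
    refine ⟨fun ψ => (inner ℂ ψ (qrOperator W ψ)).re, ?_, fun ψ => rfl⟩
    have h1 : ContDiff ℝ ((⊤ : ℕ∞) : WithTop ℕ∞) (fun ψ : Hilb E(W) => qrOperator W ψ) :=
      (qrOperator W).contDiff.restrict_scalars ℝ
    exact Complex.reCLM.contDiff.comp (contDiff_id.inner ℂ h1)
  mem_Icc := by
    rintro ⟨ψ⟩
    exact QR_mem_Icc W ψ
  extension p z hp hz := QR_productState W p z hp hz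
  entanglement := by
    intro ζ χ hζ hχ p hp z hz ψ hψ
    have hne : ζ ≠ χ := by
      rintro rfl
      exact hχ hζ
    rw [QR_toQ, Finset.sum_eq_single ζ]
    · rw [hψ, connIndicator, if_pos hζ]
      simp [ket_apply, hne, Real.sq_sqrt hp.1]
    · intro ε _ hε
      by_cases hεχ : ε = χ
      · rw [hεχ, connIndicator, if_neg hχ, zero_mul]
      · rw [hψ]
        simp [ket_apply, hε, hεχ]
    · simp

lemma isSelfAdjoint_qrOperator (W : Graph α β) : IsSelfAdjoint (qrOperator W) := by
  rw [ContinuousLinearMap.isSelfAdjoint_iff_isSymmetric]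
  intro x y
  change inner ℂ (qrOperator W x) y = inner ℂ x (qrOperator W y)
  rw [PiLp.inner_apply, PiLp.inner_apply]
  refine Finset.sum_congr rfl fun ε _ => ?_
  rw [qrOperator_apply, qrOperator_apply, RCLike.inner_apply, RCLike.inner_apply, map_mul,
    Complex.conj_ofReal]
  ring

/-- A positive operator annihilates every vector on which its quadratic form vanishes. -/
lemma apply_eq_zero_of_re_inner_eq_zero {V : Type*} [NormedAddCommGroup V] [InnerProductSpace ℂ V]
    [CompleteSpace V] {T : V →L[ℂ] V} (hT : IsSelfAdjoint T)
    (hpos : ∀ x, 0 ≤ (inner ℂ x (T x)).re) {x : V} (hx : (inner ℂ x (T x)).re = 0) : T x = 0 := by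
  have hsymm := ContinuousLinearMap.isSelfAdjoint_iff_isSymmetric.1 hT
  have h1 : inner ℂ x (T (T x)) = inner ℂ (T x) (T x) := (hsymm x (T x)).symm
  have h2 : (inner ℂ (T x) (T x) : ℂ) = ((‖T x‖ ^ 2 : ℝ) : ℂ) := by
    rw [inner_self_eq_norm_sq_to_K]; norm_cast
  -- The form at `x + t • T x` is a quadratic polynomial in `t` without constant term.
  have h3 : ∀ t : ℝ, 0 ≤ (inner ℂ (T x) (T (T x))).re * (t * t) + 2 * ‖T x‖ ^ 2 * t + 0 := by
    intro t
    have h := hpos (x + (t : ℂ) • T x)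
    simp only [map_add, map_smul, inner_add_left, inner_add_right, inner_smul_left,
      inner_smul_right, Complex.conj_ofReal, h1, h2, Complex.add_re, Complex.re_ofReal_mul,
      Complex.ofReal_re, hx] at h
    linarith
  have h4 := discrim_le_zero h3
  rw [discrim] at h4
  have h5 : ‖T x‖ ^ 2 = 0 := by nlinarith [sq_nonneg (‖T x‖ ^ 2)]
  simpa using h5

lemma re_inner_mem_Icc {W : Graph α β} {L : Hilb E(W) →L[ℂ] Hilb E(W)}
    (hL : IsQuantumReliability W (inducedFun L)) (x : Hilb E(W)) :
    (inner ℂ x (L x)).re ∈ Set.Icc (0 : ℝ) (‖x‖ ^ 2) := by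
  rcases eq_or_ne x 0 with rfl | hx
  · simp
  have hn : ‖x‖ ≠ 0 := norm_ne_zero_iff.2 hx
  have hu : ((‖x‖⁻¹ : ℝ) : ℂ) • x ∈ Metric.sphere (0 : Hilb E(W)) 1 := by
    rw [mem_sphere_zero_iff_norm, norm_smul]
    simp [hn]
  have h := hL.mem_Icc (toQ ⟨_, hu⟩)
  have h' : inducedFun L (toQ ⟨_, hu⟩) = ‖x‖⁻¹ * (‖x‖⁻¹ * (inner ℂ x (L x)).re) := by
    change (inner ℂ (((‖x‖⁻¹ : ℝ) : ℂ) • x) (L (((‖x‖⁻¹ : ℝ) : ℂ) • x))).re = _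
    rw [map_smul, inner_smul_left, inner_smul_right, Complex.conj_ofReal, Complex.re_ofReal_mul,
      Complex.re_ofReal_mul]
  rw [h'] at h
  have hpos : 0 < ‖x‖ := norm_pos_iff.2 hx
  have h2 : (inner ℂ x (L x)).re = ‖x‖ ^ 2 * (‖x‖⁻¹ * (‖x‖⁻¹ * (inner ℂ x (L x)).re)) := by
    field_simp
  rw [h2]
  exact ⟨mul_nonneg (sq_nonneg _) h.1, mul_le_of_le_one_right (sq_nonneg _) h.2⟩

/-- The extension axiom at deterministic parameters `p e ∈ {0, 1}` prescribes the diagonal of an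
operator which induces a quantum reliability. -/
lemma re_inner_ket {W : Graph α β} {L : Hilb E(W) →L[ℂ] Hilb E(W)}
    (hL : IsQuantumReliability W (inducedFun L)) (ε : CState E(W)) :
    (inner ℂ (ket ε) (L (ket ε))).re = connIndicator W ε := by
  classical
  set p : β → ℝ := fun e => if h : e ∈ E(W) then (if ε ⟨e, h⟩ = true then 1 else 0) else 0 with hp_def
  have hp : ∀ e, p e ∈ Set.Icc (0 : ℝ) 1 := by
    intro e
    simp only [hp_def]
    split_ifs <;> simp
  have hpe : ∀ e : ↥E(W), p e = if ε e = true then 1 else 0 := fun e => by simp [hp_def]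
  have hneq : ∀ {χ : CState E(W)}, χ ≠ ε → ∃ e, χ e ≠ ε e := fun h => Function.ne_iff.1 h
  have hket : (productState E(W) p (fun _ => 1) hp (fun _ => norm_one)).1 = ket ε := by
    ext χ
    have h : (productState E(W) p (fun _ => 1) hp (fun _ => norm_one)).1 χ =
      ∏ e : ↥E(W), qubitCoeff (p e) 1 (χ e) := rfl
    rw [h, ket_apply]
    split_ifs with hχ
    · refine Finset.prod_eq_one fun e _ => ?_
      by_cases he : ε e = true <;> simp [hχ, qubitCoeff, hpe, he]
    · obtain ⟨e, he⟩ := hneq hχ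
      refine Finset.prod_eq_zero (Finset.mem_univ e) ?_
      by_cases hε : ε e = true <;> simp_all [qubitCoeff]
  have hprob : ∀ χ : CState E(W), stateProb p χ = if χ = ε then 1 else 0 := by
    intro χ
    rw [← norm_sq_productState p (fun _ => 1) hp (fun _ => norm_one), hket, ket_apply]
    split_ifs <;> simp
  have h := hL.extension p (fun _ => 1) hp (fun _ => norm_one)
  have h' : inducedFun L (toQ (productState E(W) p (fun _ => 1) hp (fun _ => norm_one))) =
    (inner ℂ (productState E(W) p (fun _ => 1) hp (fun _ => norm_one)).1
      (L (productState E(W) p (fun _ => 1) hp (fun _ => norm_one)).1)).re := rfl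
  rw [h', hket, reliability_eq_sum] at h
  rw [h]
  simp [hprob]

/-- The operator inducing a quantum reliability lies between `0` and `1` and its diagonal entries are
`0` or `1`, so every basis vector is an eigenvector with the diagonal entry as eigenvalue. -/
lemma isUniqueQROperator_qrOperator (W : Graph α β) : IsUniqueQROperator W (qrOperator W) := by
  refine ⟨⟨isSelfAdjoint_qrOperator W, isQuantumReliability_QR W⟩, fun L hLs hL => ?_⟩
  have hket : ∀ ε, L (ket ε) = qrOperator W (ket ε) := by
    intro ε
    have hq : qrOperator W (ket ε) = (connIndicator W ε : ℂ) • ket ε := by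
      ext χ
      rw [qrOperator_apply, PiLp.smul_apply, smul_eq_mul, ket_apply]
      split_ifs with h
      · rw [h]
      · simp
    have hd := re_inner_ket hL ε
    have hnorm : ‖ket ε‖ = 1 := by simp [ket]
    rw [hq]
    by_cases hε : IsConnectedState W ε
    · rw [connIndicator, if_pos hε] at hd ⊢
      have hself : IsSelfAdjoint (1 - L) := by
        rw [ContinuousLinearMap.isSelfAdjoint_iff_isSymmetric] at hLs ⊢
        exact LinearMap.IsSymmetric.id.sub hLs
      have hform : ∀ x, (inner ℂ x ((1 - L) x)).re = ‖x‖ ^ 2 - (inner ℂ x (L x)).re := by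
        intro x
        rw [sub_apply, one_apply_eq_self, inner_sub_right,
          Complex.sub_re, inner_self_eq_norm_sq_to_K]
        norm_cast
      have h0 := apply_eq_zero_of_re_inner_eq_zero hself (x := ket ε)
        (fun x => by rw [hform]; linarith [(re_inner_mem_Icc hL x).2])
        (by rw [hform, hd, hnorm]; norm_num)
      rw [sub_apply, one_apply_eq_self, sub_eq_zero] at h0
      rw [← h0]
      simp
    · rw [connIndicator, if_neg hε] at hd ⊢
      rw [apply_eq_zero_of_re_inner_eq_zero hLs (fun x => (re_inner_mem_Icc hL x).1) hd]
      simp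
  apply ContinuousLinearMap.coe_injective
  refine (EuclideanSpace.basisFun (CState E(W)) ℂ).toBasis.ext fun ε => ?_
  simpa [ket] using hket ε

end Reliability

/-! ### The splitting formula -/

section Splitting

variable {α β : Type*}

open Classical in
/-- The indicator function of `ReachesSet`. -/
noncomputable def reachIndicator (W : Graph α β) (U : Set α) (ε : CState E(W)) : ℝ :=
  if ReachesSet W U ε then 1 else 0

lemma connIndicator_identify (W : Graph α β) {U : Set α} (hU : U ⊆ V(W)) (hne : U.Nonempty)
    (γ : Setoid U) (ε : CState E(W)) :
    connIndicator (identify W γ) ε =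
      reachIndicator W U ε * connMatrix U (boundaryPartition W U ε) γ := by
  have h := isConnectedState_identify_iff W hU hne γ ε
  simp only [connIndicator, reachIndicator, connMatrix, Matrix.of_apply, h]
  split_ifs <;> simp_all

lemma connIndicator_eq_mul_connMatrix {G K H : Graph α β} (h : IsUnionOf G K H)
    (hne : (V(K) ∩ V(H)).Nonempty) (ε : CState E(G)) :
    connIndicator G ε =
      reachIndicator K (V(K) ∩ V(H)) (ε.restrict h.left_le.edgeSet_mono) *
      reachIndicator H (V(K) ∩ V(H)) (ε.restrict h.right_le.edgeSet_mono) *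
      connMatrix (V(K) ∩ V(H))
        (boundaryPartition K (V(K) ∩ V(H)) (ε.restrict h.left_le.edgeSet_mono))
        (boundaryPartition H (V(K) ∩ V(H)) (ε.restrict h.right_le.edgeSet_mono)) := by
  have hiff := isConnectedState_union_iff h hne ε
  rw [connIndicator, reachIndicator, reachIndicator, connMatrix, Matrix.of_apply]
  by_cases hconn : IsConnectedState G ε
  · obtain ⟨hK, hH, hcard⟩ := hiff.1 hconn
    rw [if_pos hconn, if_pos hK, if_pos hH, if_pos hcard, one_mul, one_mul]
  · rw [if_neg hconn]
    split_ifs with hK hH hcard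
    · exact absurd (hiff.2 ⟨hK, hH, hcard⟩) hconn
    all_goals simp

lemma connMatrix_comm (U : Set α) (γ γ' : Setoid U) : connMatrix U γ γ' = connMatrix U γ' γ := by
  simp only [connMatrix, Matrix.of_apply, sup_comm γ γ']

/-- The splitting formula for indicators of connected states, which is the entry of the matrix
identity `A * A⁻¹ * A = A` at the partitions induced on the shared vertices. -/
lemma connIndicator_union [Finite α] {G K H : Graph α β} (h : IsUnionOf G K H)
    (hne : (V(K) ∩ V(H)).Nonempty) (ε : CState E(G)) :
    connIndicator G ε = ∑ γ : Setoid ↥(V(K) ∩ V(H)), ∑ γ' : Setoid ↥(V(K) ∩ V(H)),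
      splitCoeff (V(K) ∩ V(H)) γ γ' *
        connIndicator (identify K γ) (ε.restrict h.left_le.edgeSet_mono) *
        connIndicator (identify H γ') (ε.restrict h.right_le.edgeSet_mono) := by
  have hA : connMatrix (V(K) ∩ V(H)) * splitCoeff (V(K) ∩ V(H)) * connMatrix (V(K) ∩ V(H)) =
      connMatrix (V(K) ∩ V(H)) := by
    rw [splitCoeff, Matrix.mul_nonsing_inv _ (isUnit_det_connMatrix hne), one_mul]
  have hK : ∀ γ, connIndicator (identify K γ) (ε.restrict h.left_le.edgeSet_mono) = _ := fun γ =>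
    connIndicator_identify K Set.inter_subset_left hne γ (ε.restrict h.left_le.edgeSet_mono)
  have hH : ∀ γ, connIndicator (identify H γ) (ε.restrict h.right_le.edgeSet_mono) = _ := fun γ =>
    connIndicator_identify H Set.inter_subset_right hne γ (ε.restrict h.right_le.edgeSet_mono)
  rw [connIndicator_eq_mul_connMatrix h hne]
  nth_rewrite 1 [← hA]
  simp only [Matrix.mul_apply, Finset.mul_sum, Finset.sum_mul]
  rw [Finset.sum_comm]
  refine Finset.sum_congr rfl fun γ _ => Finset.sum_congr rfl fun γ' _ => ?_
  rw [hK, hH, connMatrix_comm _ γ']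
  ring

variable [Finite β]

lemma sum_restrict_mul_restrict {G K H : Graph α β} (h : IsUnionOf G K H)
    (a : CState E(K) → ℝ) (b : CState E(H) → ℝ) :
    ∑ ε : CState E(G), a (ε.restrict h.left_le.edgeSet_mono) *
      b (ε.restrict h.right_le.edgeSet_mono) = (∑ ε, a ε) * ∑ ε, b ε := by
  rw [Finset.sum_mul_sum, ← Fintype.sum_prod_type']
  exact (splitState h.edgeSet_eq h.edgeSet_disjoint).sum_comp fun q => a q.1 * b q.2

lemma prod_edgeSet_union {M : Type*} [CommMonoid M] {G K H : Graph α β} (h : IsUnionOf G K H)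
    (f : ↥E(G) → M) :
    ∏ e, f e = (∏ e : ↥E(K), f ⟨e, h.left_le.edgeSet_mono e.2⟩) *
      ∏ e : ↥E(H), f ⟨e, h.right_le.edgeSet_mono e.2⟩ := by
  classical
  have hsum := Fintype.prod_sum_type fun e : ↥E(K) ⊕ ↥E(H) => f (e.elim
    (fun e => (⟨e.1, h.left_le.edgeSet_mono e.2⟩ : ↥E(G)))
    fun e => ⟨e.1, h.right_le.edgeSet_mono e.2⟩)
  refine Eq.trans ?_ hsum
  symm
  refine Fintype.prod_bijective _ ⟨?_, ?_⟩ _ _ fun _ => rfl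
  · rintro (a | a) (b | b) hab
    · exact congrArg Sum.inl (Subtype.ext (congrArg (fun e : ↥E(G) => e.1) hab))
    · exact absurd b.2 (Set.disjoint_left.1 h.edgeSet_disjoint (congrArg Subtype.val hab ▸ a.2))
    · exact absurd a.2 (Set.disjoint_left.1 h.edgeSet_disjoint (congrArg Subtype.val hab ▸ b.2))
    · exact congrArg Sum.inr (Subtype.ext (congrArg (fun e : ↥E(G) => e.1) hab))
  · rintro ⟨e, he⟩
    rcases (h.edgeSet_eq ▸ he : e ∈ E(K) ∪ E(H)) with heK | heH
    · exact ⟨Sum.inl ⟨e, heK⟩, rfl⟩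
    · exact ⟨Sum.inr ⟨e, heH⟩, rfl⟩

lemma productState_eq_tensor {G K H : Graph α β} (h : IsUnionOf G K H) (p : β → ℝ) (z : β → ℂ)
    (hp : ∀ e, p e ∈ Set.Icc (0 : ℝ) 1) (hz : ∀ e, ‖z e‖ = 1) :
    productState E(G) p z hp hz =
      tensor h (productState E(K) p z hp hz) (productState E(H) p z hp hz) := by
  apply Subtype.ext
  ext ε
  exact prod_edgeSet_union h fun e => qubitCoeff (p e) (z e) (ε e)

lemma stateProb_union {G K H : Graph α β} (h : IsUnionOf G K H) (p : β → ℝ) (ε : CState E(G)) :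
    stateProb p ε = stateProb p (ε.restrict h.left_le.edgeSet_mono) *
      stateProb p (ε.restrict h.right_le.edgeSet_mono) :=
  prod_edgeSet_union h fun e => if ε e = true then p e else 1 - p e

/-- The splitting formula for any weights on the states of `G` that factorize over `K` and `H`. -/
lemma sum_connIndicator_union [Finite α] {G K H : Graph α β} (h : IsUnionOf G K H)
    (hne : (V(K) ∩ V(H)).Nonempty) (a : CState E(K) → ℝ) (b : CState E(H) → ℝ) :
    ∑ ε : CState E(G), connIndicator G ε * (a (ε.restrict h.left_le.edgeSet_mono) *
      b (ε.restrict h.right_le.edgeSet_mono)) =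
    ∑ γ : Setoid ↥(V(K) ∩ V(H)), ∑ γ' : Setoid ↥(V(K) ∩ V(H)),
      splitCoeff (V(K) ∩ V(H)) γ γ' *
        (∑ ε : CState E(K), connIndicator (identify K γ) ε * a ε) *
        (∑ ε : CState E(H), connIndicator (identify H γ') ε * b ε) := by
  have hterm : ∀ γ γ' : Setoid ↥(V(K) ∩ V(H)), splitCoeff (V(K) ∩ V(H)) γ γ' *
        (∑ ε : CState E(K), connIndicator (identify K γ) ε * a ε) *
        (∑ ε : CState E(H), connIndicator (identify H γ') ε * b ε) =
      ∑ ε : CState E(G), splitCoeff (V(K) ∩ V(H)) γ γ' *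
        (connIndicator (identify K γ) (ε.restrict h.left_le.edgeSet_mono) *
          a (ε.restrict h.left_le.edgeSet_mono) *
        (connIndicator (identify H γ') (ε.restrict h.right_le.edgeSet_mono) *
          b (ε.restrict h.right_le.edgeSet_mono))) := by
    intro γ γ'
    rw [mul_assoc, ← Finset.mul_sum]
    exact congrArg _ (sum_restrict_mul_restrict h
      (fun ε => connIndicator (identify K γ) ε * a ε)
      (fun ε => connIndicator (identify H γ') ε * b ε)).symm
  simp only [hterm]
  rw [Finset.sum_congr rfl fun γ _ => Finset.sum_comm, Finset.sum_comm]
  refine Finset.sum_congr rfl fun ε _ => ?_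
  rw [connIndicator_union h hne, Finset.sum_mul]
  refine Finset.sum_congr rfl fun γ _ => ?_
  rw [Finset.sum_mul]
  refine Finset.sum_congr rfl fun γ' _ => ?_
  ring

lemma QR_tensor [Finite α] {G K H : Graph α β} (h : IsUnionOf G K H)
    (hne : (V(K) ∩ V(H)).Nonempty) (ψK : Sph E(K)) (ψH : Sph E(H)) :
    QR G (toQ (tensor h ψK ψH)) =
      ∑ γ : Setoid ↥(V(K) ∩ V(H)), ∑ γ' : Setoid ↥(V(K) ∩ V(H)),
        splitCoeff (V(K) ∩ V(H)) γ γ' *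
          QR (identify K γ) (toQ ψK) * QR (identify H γ') (toQ ψH) := by
  have hQ : ∀ (W : Graph α β) (γ : Setoid ↥(V(K) ∩ V(H))) (ψ : Sph E(W)),
      QR (identify W γ) (toQ ψ) =
        ∑ ε : CState E(W), connIndicator (identify W γ) ε * ‖ψ.1 ε‖ ^ 2 :=
    fun W γ ψ => QR_toQ (identify W γ) ψ
  simp only [hQ]
  rw [← sum_connIndicator_union h hne, QR_toQ]
  refine Finset.sum_congr rfl fun ε _ => ?_
  rw [← mul_pow, ← norm_mul]
  rfl

lemma reliability_union [Finite α] {G K H : Graph α β} (h : IsUnionOf G K H)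
    (hne : (V(K) ∩ V(H)).Nonempty) (p : β → ℝ) :
    reliability G p =
      ∑ γ : Setoid ↥(V(K) ∩ V(H)), ∑ γ' : Setoid ↥(V(K) ∩ V(H)),
        splitCoeff (V(K) ∩ V(H)) γ γ' *
          reliability (identify K γ) p * reliability (identify H γ') p := by
  have hR : ∀ (W : Graph α β) (γ : Setoid ↥(V(K) ∩ V(H))),
      reliability (identify W γ) p =
        ∑ ε : CState E(W), connIndicator (identify W γ) ε * stateProb p ε :=
    fun W γ => reliability_eq_sum (identify W γ) p
  simp only [hR]
  rw [← sum_connIndicator_union h hne, reliability_eq_sum]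
  simp only [stateProb_union h]

end Splitting

/-! ### Deletion and contraction of an edge -/

section SimpleFactorization

variable {α β : Type*}

lemma deleteEdges_eq_of_isUnionOf {G K H : Graph α β} (h : IsUnionOf G K H)
    (hV : V(K) ⊆ V(H)) {e : β} (hE : E(K) = {e}) : G.deleteEdges {e} = H := by
  refine Graph.ext ?_ fun f x y => ?_
  · rw [Graph.vertexSet_deleteEdges, h.vertexSet_eq, Set.union_eq_self_of_subset_left hV]
  · rw [Graph.deleteEdges_isLink, ← hE]
    constructor
    · rintro ⟨hl, hf⟩
      have hfH : f ∈ E(H) :=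
        (h.edgeSet_eq ▸ hl.edge_mem : f ∈ E(K) ∪ E(H)).resolve_left hf
      exact (h.right_le.isLink_iff hfH).2 hl
    · exact fun hl => ⟨hl.mono h.right_le, Set.disjoint_right.1 h.edgeSet_disjoint hl.edge_mem⟩

lemma pathSetoid_stateGraph_of_edge {G K : Graph α β} (hK : K ≤ G) {e : β} (hE : E(K) = {e})
    {ε : CState E(K)} {he : e ∈ E(K)} (hε : ε ⟨e, he⟩ = true) :
    pathSetoid (stateGraph K ε) = endsSetoid G e := by
  apply le_antisymm
  · refine pathSetoid_le_iff.2 ?_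
    rintro x y ⟨f, ⟨hf, -⟩, hl⟩
    obtain rfl : f = e := by simpa [hE] using hf
    exact Or.inr (hl.mono hK)
  · rintro x y (rfl | hl)
    · exact Setoid.refl' _ x
    · exact pathSetoid_of_adj ⟨e, ⟨he, hε⟩, (hK.isLink_iff he).2 hl⟩

lemma pathSetoid_stateGraph_of_not_edge {K : Graph α β} {e : β} (hE : E(K) = {e})
    {ε : CState E(K)} {he : e ∈ E(K)} (hε : ¬ ε ⟨e, he⟩ = true) :
    pathSetoid (stateGraph K ε) = ⊥ := by
  refine le_bot_iff.1 (pathSetoid_le_iff.2 ?_)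
  rintro x y ⟨f, ⟨hf, hf'⟩, -⟩
  obtain rfl : f = e := by simpa [hE] using hf
  exact absurd hf' hε

/-- If `K` consists of the edge `e` between shared vertices and `e` is present, connectedness of a
state of `G` is connectedness of its restriction to `H` after contraction of `e`. -/
lemma isConnectedState_iff_of_edge {G K H : Graph α β} (h : IsUnionOf G K H)
    (hV : V(K) ⊆ V(H)) {e : β} (hE : E(K) = {e}) {he : e ∈ E(K)} {ε : CState E(G)}
    (hε : ε.restrict h.left_le.edgeSet_mono ⟨e, he⟩ = true) :
    IsConnectedState G ε ↔ IsConnectedState (H.map (Quotient.mk (endsSetoid G e)))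
      (ε.restrict h.right_le.edgeSet_mono) := by
  have hV' : V(stateGraph G ε) = V(H) :=
    h.vertexSet_eq.trans (Set.union_eq_self_of_subset_left hV)
  have hW : ∀ η : CState E(H), V(stateGraph H η) = V(H) := fun _ => rfl
  have h1 : IsConnectedState (H.map (Quotient.mk (endsSetoid G e)))
      (ε.restrict h.right_le.edgeSet_mono) ↔ IsConnected ((stateGraph H
        (ε.restrict h.right_le.edgeSet_mono)).map (Quotient.mk (endsSetoid G e))) := by
    rw [← stateGraph_map]; rfl
  have hker : Setoid.ker (Quotient.mk (endsSetoid G e)) = endsSetoid G e := Setoid.ker_mk_eq _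
  rw [h1, isConnected_map_iff, hker, hW, IsConnectedState, isConnected_iff, hV',
    pathSetoid_stateGraph_union h, pathSetoid_stateGraph_of_edge h.left_le hE hε, sup_comm]

lemma isConnectedState_iff_of_not_edge {G K H : Graph α β} (h : IsUnionOf G K H)
    (hV : V(K) ⊆ V(H)) {e : β} (hE : E(K) = {e}) {he : e ∈ E(K)} {ε : CState E(G)}
    (hε : ¬ ε.restrict h.left_le.edgeSet_mono ⟨e, he⟩ = true) :
    IsConnectedState G ε ↔ IsConnectedState H (ε.restrict h.right_le.edgeSet_mono) := by
  have hV' : V(stateGraph G ε) = V(H) :=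
    h.vertexSet_eq.trans (Set.union_eq_self_of_subset_left hV)
  rw [IsConnectedState, isConnected_iff, hV', pathSetoid_stateGraph_union h,
    pathSetoid_stateGraph_of_not_edge hE hε, bot_sup_eq]
  rfl

variable [Finite β]

lemma sum_stateProb_singleton {E : Set β} {e : β} (hE : E = {e}) (he : e ∈ E) (p : β → ℝ)
    (f : Bool → ℝ) :
    ∑ ε : CState E, f (ε ⟨e, he⟩) * stateProb p ε = f true * p e + f false * (1 - p e) := by
  let _ : Unique ↥E := ⟨⟨⟨e, he⟩⟩, fun x => Subtype.ext (by simpa [hE] using x.2)⟩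
  have h : ∀ ε : CState E, stateProb p ε = if ε ⟨e, he⟩ = true then p e else 1 - p e := fun ε => by
    rw [stateProb, Fintype.prod_subsingleton _ ⟨e, he⟩]
  have hs : ∑ ε : CState E, f (ε ⟨e, he⟩) * stateProb p ε =
      ∑ b : Bool, f b * (if b = true then p e else 1 - p e) := by
    refine Fintype.sum_equiv (show CState E ≃ Bool from Equiv.funUnique ↥E Bool) _ _ fun ε => ?_
    rw [h]
    rfl
  rw [hs]
  simp

/-- Conditioning on the state of the edge `e`. -/
lemma reliability_eq_of_edge {G K H : Graph α β} (h : IsUnionOf G K H)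
    (hV : V(K) ⊆ V(H)) {e : β} (hE : E(K) = {e}) (p : β → ℝ) :
    reliability G p = p e * reliability (contractEdge G e) p +
      (1 - p e) * reliability (G.deleteEdges {e}) p := by
  have he : e ∈ E(K) := by rw [hE]; rfl
  rw [contractEdge, deleteEdges_eq_of_isUnionOf h hV hE]
  have hc : reliability (H.map (Quotient.mk (endsSetoid G e))) p = ∑ ε : CState E(H),
      connIndicator (H.map (Quotient.mk (endsSetoid G e))) ε * stateProb p ε :=
    reliability_eq_sum (H.map (Quotient.mk (endsSetoid G e))) p
  have h1 := sum_stateProb_singleton hE he p fun b => if b = true then 1 else 0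
  have h0 := sum_stateProb_singleton hE he p fun b => if b = true then 0 else 1
  simp only [if_true, Bool.false_eq_true, if_false, one_mul, zero_mul, add_zero, zero_add] at h1 h0
  have s1 := (sum_restrict_mul_restrict h
    (fun ε => (if ε ⟨e, he⟩ = true then 1 else 0) * stateProb p ε)
    (fun ε => connIndicator (H.map (Quotient.mk (endsSetoid G e))) ε * stateProb p ε)).trans
      (congrArg (· * _) h1)
  have s0 := (sum_restrict_mul_restrict h
    (fun ε => (if ε ⟨e, he⟩ = true then 0 else 1) * stateProb p ε)
    (fun ε => connIndicator H ε * stateProb p ε)).trans (congrArg (· * _) h0)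
  rw [hc, reliability_eq_sum H, reliability_eq_sum G]
  refine Eq.trans ?_ (congrArg₂ (· + ·) s1 s0)
  rw [← Finset.sum_add_distrib]
  refine Finset.sum_congr rfl fun ε _ => ?_
  rw [stateProb_union h]
  by_cases hε : ε.restrict h.left_le.edgeSet_mono ⟨e, he⟩ = true
  · have hi : connIndicator G ε = connIndicator (H.map (Quotient.mk (endsSetoid G e)))
        (ε.restrict (F := E(H)) h.right_le.edgeSet_mono) :=
      connIndicator_congr (isConnectedState_iff_of_edge h hV hE hε)
    rw [if_pos hε, if_pos hε, hi]
    ring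
  · have hi : connIndicator G ε = connIndicator H (ε.restrict h.right_le.edgeSet_mono) :=
      connIndicator_congr (isConnectedState_iff_of_not_edge h hV hE hε)
    rw [if_neg hε, if_neg hε, hi]
    ring

end SimpleFactorization

end QNet

open QNet in
theorem corollary1 {α β : Type*} [Finite α] [Finite β] (G K H : Graph α β)
    (hG : IsUnionOf G K H) (U : Set α) (hU : U = V(K) ∩ V(H)) (hne : U.Nonempty) :
    -- the connectivity matrix is invertible, so that its inverse is meaningful
    IsUnit (connMatrix U).det ∧
    -- the operators that induce `QR` are the unique ones that induce quantum reliabilities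
    IsUniqueQROperator G (qrOperator G) ∧
    (∀ γ : Setoid U, IsUniqueQROperator (identify K γ) (qrOperator (identify K γ)) ∧
      IsUniqueQROperator (identify H γ) (qrOperator (identify H γ))) ∧
    -- the splitting on product states
    (∀ (ψK : Sph E(K)) (ψH : Sph E(H)),
      QR G (toQ (tensor hG ψK ψH)) =
        ∑ γ : Setoid U, ∑ γ' : Setoid U, splitCoeff U γ γ' *
          QR (identify K γ) (toQ ψK) * QR (identify H γ') (toQ ψH)) ∧
    -- evaluation on non entangled states gives the classical splitting
    (∀ (p : β → ℝ) (z : β → ℂ) (hp : ∀ e, p e ∈ Set.Icc (0 : ℝ) 1) (hz : ∀ e, ‖z e‖ = 1),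
      productState E(G) p z hp hz =
          tensor hG (productState E(K) p z hp hz) (productState E(H) p z hp hz) ∧
      QR G (toQ (productState E(G) p z hp hz)) = reliability G p ∧
      (∀ γ : Setoid U,
        QR (identify K γ) (toQ (productState E(K) p z hp hz)) = reliability (identify K γ) p ∧
        QR (identify H γ) (toQ (productState E(H) p z hp hz)) = reliability (identify H γ) p) ∧
      reliability G p =
        ∑ γ : Setoid U, ∑ γ' : Setoid U, splitCoeff U γ γ' *
          reliability (identify K γ) p * reliability (identify H γ') p) ∧
    -- two shared nodes and `K` a single edge joining them: simple factorization
    (∀ (e : β) (u v : α), u ≠ v → U = {u, v} → V(K) = {u, v} → E(K) = {e} → K.IsLink e u v →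
      ∀ p : β → ℝ, (∀ e, p e ∈ Set.Icc (0 : ℝ) 1) →
        ∑ γ : Setoid U, ∑ γ' : Setoid U, splitCoeff U γ γ' *
            reliability (identify K γ) p * reliability (identify H γ') p =
          p e * reliability (contractEdge G e) p +
            (1 - p e) * reliability (G.deleteEdges {e}) p ∧
        reliability G p =
          p e * reliability (contractEdge G e) p +
            (1 - p e) * reliability (G.deleteEdges {e}) p) := by
  subst hU
  refine ⟨isUnit_det_connMatrix hne, isUniqueQROperator_qrOperator G,
    fun γ => ⟨isUniqueQROperator_qrOperator _, isUniqueQROperator_qrOperator _⟩,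
    QR_tensor hG hne, fun p z hp hz => ⟨productState_eq_tensor hG p z hp hz,
      QR_productState G p z hp hz, fun γ => ⟨QR_productState (identify K γ) p z hp hz,
        QR_productState (identify H γ) p z hp hz⟩, reliability_union hG hne p⟩, ?_⟩
  intro e u v _ hUuv hV hE _ p _
  have hVH : V(K) ⊆ V(H) := by
    rw [hV, ← hUuv]
    exact Set.inter_subset_right
  have h := reliability_eq_of_edge hG hVH hE p
  exact ⟨by rw [← reliability_union hG hne, h], h⟩
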